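/- Let $G_\infty=\bigcup_n G_n$ be a Hausdorff topological group which is the direct limit (with the direct-limit topology) of an increasing sequence of locally compact subgroups $G_n$, and let $K_n\le G_n$ be an increasing sequence of compact subgroups such that each $(G_n,K_n)$ is a Gelfand pair (i.e. the convolution algebra $L^1(K_n\backslash G_n/K_n)$ is commutative) and $G_n\cap K_{n+1}=K_n$ for all $n$; put $K_\infty=\bigcup_n K_n$. Let $\mathrm{RUC}_b(K_\infty)$ be the algebra of bounded functions $f:K_\infty\to\mathbb C$ for which $g\mapsto L_gf$, $L_gf(h)=f(g^{-1}h)$, is norm continuous from $K_\infty$ to $\ell^\infty(K_\infty)$. An invariant mean is a continuous linear functional $\mu$ on $\mathrm{RUC}_b(K_\infty)$ with $\mu(\mathbf 1)=1$, $\mu(f)\ge 0$ for $f\ge 0$, and $\mu(L_gf)=\mu(f)$ for all $g\in K_\infty$. A continuous function $\varphi:G_\infty\to\mathbb C$ is spherical with respect to a functional $\mu$ on $\mathrm{RUC}_b(K_\infty)$ if for all $x,y\in G_\infty$ the function $k\mapsto\varphi(xky)$ belongs to $\mathrm{RUC}_b(K_\infty)$ and $\mu\big(k\mapsto\varphi(xky)\big)=\varphi(x)\varphi(y)$.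 A spherical function on $G_\infty$ is a positive-definite function $\varphi$ with $\varphi(e)=1$ which is spherical with respect to some invariant mean. Suppose that $K_\infty$ is extremely amenable, i.e. there is a $K_\infty$-invariant character of $\mathrm{RUC}_b(K_\infty)$. Then: (a) if $\varphi$ and $\psi$ are spherical functions on $G_\infty$ (possibly with respect to different invariant means), then $\varphi\psi$ is a spherical function on $G_\infty$, and it is spherical with respect to every invariant mean on $\mathrm{RUC}_b(K_\infty)$; (b) for every $K_\infty$-invariant character $\chi$ of $\mathrm{RUC}_b(K_\infty)$, the product of any two continuous (not necessarily positive-definite) functions on $G_\infty$ that are spherical with respect to $\chi$ is spherical with respect to $\chi$. -/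

import Mathlib

open scoped ENNReal ComplexOrder

/-- The commutative C⋆-algebra `l^∞(H)` of all bounded functions `H → ℂ`, with the sup norm. -/
noncomputable abbrev BddFun (H : Type*) := lp (fun _ : H => ℂ) ∞

section Translation

variable {H : Type*} [Group H]

/-- Left translation on bounded functions: `(L_g f)(h) = f (g⁻¹ h)`. -/
def leftTrans (g : H) (f : BddFun H) : BddFun H :=
  ⟨fun h => f (g⁻¹ * h), by
    obtain ⟨C, hC⟩ := memℓp_infty_iff.1 (lp.memℓp f)
    refine memℓp_infty_iff.2 ⟨C, ?_⟩
    rintro _ ⟨h, rfl⟩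
    exact hC ⟨g⁻¹ * h, rfl⟩⟩

@[simp] theorem leftTrans_apply (g h : H) (f : BddFun H) : leftTrans g f h = f (g⁻¹ * h) := rfl

theorem leftTrans_leftTrans (a b : H) (f : BddFun H) :
    leftTrans a (leftTrans b f) = leftTrans (a * b) f := by
  ext h
  simp [mul_assoc]

end Translation

section RUC

variable (H : Type*) [Group H] [TopologicalSpace H] [IsTopologicalGroup H]

/-- The algebra `RUC_b(H)`: the bounded functions `f` on `H` such that `g ↦ L_g f` is a
continuous map from `H` to `l^∞(H)`. -/
def RUCb : StarSubalgebra ℂ (BddFun H) where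
  carrier := {f | Continuous fun g : H => leftTrans g f}
  mul_mem' {a b} ha hb := by
    have : (fun g : H => leftTrans g (a * b)) = fun g => leftTrans g a * leftTrans g b := by
      funext g; ext h; simp
    simp only [Set.mem_ofPred_eq] at ha hb ⊢
    rw [this]; exact ha.mul hb
  add_mem' {a b} ha hb := by
    have : (fun g : H => leftTrans g (a + b)) = fun g => leftTrans g a + leftTrans g b := by
      funext g; ext h; simp
    simp only [Set.mem_ofPred_eq] at ha hb ⊢
    rw [this]; exact ha.add hb
  algebraMap_mem' r := by
    have : (fun g : H => leftTrans g (algebraMap ℂ (BddFun H) r)) =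
        fun _ => algebraMap ℂ (BddFun H) r := by
      funext g; ext h; rfl
    simp only [Set.mem_ofPred_eq]
    rw [this]; exact continuous_const
  star_mem' {a} ha := by
    have : (fun g : H => leftTrans g (star a)) = fun g => star (leftTrans g a) := by
      funext g; ext h; simp
    simp only [Set.mem_ofPred_eq] at ha ⊢
    rw [this]; exact ha.star

variable {H}

/-- Left translation as an operation on `RUC_b(H)`. -/
def RUCb.trans (g : H) (f : RUCb H) : RUCb H :=
  ⟨leftTrans g f, by
    have hf : Continuous fun a : H => leftTrans a (f : BddFun H) := f.2
    have : (fun a : H => leftTrans a (leftTrans g (f : BddFun H))) =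
        fun a => leftTrans (a * g) (f : BddFun H) := by
      funext a; exact leftTrans_leftTrans a g f
    change Continuous fun a : H => leftTrans a (leftTrans g (f : BddFun H))
    rw [this]; exact hf.comp (continuous_id.mul continuous_const)⟩

/-- A functional on `RUC_b(H)` is invariant if `μ (L_g f) = μ f` for all `g` and `f`. -/
def IsLeftInvariant (μ : RUCb H → ℂ) : Prop :=
  ∀ (g : H) (f : RUCb H), μ (RUCb.trans g f) = μ f

/-- An invariant mean on `RUC_b(H)`: a continuous linear functional with `μ 1 = 1`, nonnegative on
pointwise nonnegative functions, and invariant under left translations. -/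
structure IsInvariantMean (μ : RUCb H →L[ℂ] ℂ) : Prop where
  map_one : μ 1 = 1
  nonneg : ∀ f : RUCb H, (∀ h, 0 ≤ (f : BddFun H) h) → 0 ≤ μ f
  invariant : IsLeftInvariant μ

variable (H) in
/-- `H` is extremely amenable: there is an `H`-invariant character of the algebra `RUC_b(H)`. -/
def IsExtremelyAmenable : Prop :=
  ∃ χ : WeakDual.characterSpace ℂ (RUCb H), IsLeftInvariant χ

end RUC

section Gelfand

open MeasureTheory

variable {H : Type*} [Group H] [TopologicalSpace H] [IsTopologicalGroup H]

/-- Convolution on a group with respect to a measure: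
`(f * g)(x) = ∫ f(y) g(y⁻¹ x) dμ(y)`. -/
noncomputable def groupConv [MeasurableSpace H] (μ : Measure H) (f g : H → ℂ) (x : H) : ℂ :=
  ∫ y, f y * g (y⁻¹ * x) ∂μ

/-- `f` represents an element of `L¹(K\H/K)`: it is integrable, and each left or right translate
of it by an element of `K` is equal to it almost everywhere. -/
structure IsBiInvariantL1 [MeasurableSpace H] (μ : Measure H) (K : Subgroup H) (f : H → ℂ) :
    Prop where
  integrable : Integrable f μ
  left_inv : ∀ k ∈ K, (fun x => f (k * x)) =ᵐ[μ] f
  right_inv : ∀ k ∈ K, (fun x => f (x * k)) =ᵐ[μ] f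

/-- `(H, K)` is a Gelfand pair: `H` is locally compact, `K` is compact, and convolution with
respect to Haar measure is commutative on `L¹(K\H/K)`. -/
structure IsGelfandPair (K : Subgroup H) : Prop where
  locallyCompact : LocallyCompactSpace H
  isCompact : IsCompact (K : Set H)
  conv_comm :
    letI : MeasurableSpace H := borel H
    haveI : BorelSpace H := ⟨rfl⟩
    haveI := locallyCompact
    ∀ f g : H → ℂ, IsBiInvariantL1 Measure.haar K f → IsBiInvariantL1 Measure.haar K g →
      groupConv Measure.haar f g =ᵐ[Measure.haar] groupConv Measure.haar g f

end Gelfand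

section Spherical

variable {G : Type*} [Group G] [TopologicalSpace G] [IsTopologicalGroup G]

/-- `G` together with its subgroup `⨆ n, Ks n` is the direct-limit Gelfand pair of the increasing
sequence of Gelfand pairs `(Gs n, Ks n)`: `G` is the union of the `Gs n`, it carries the
direct-limit (final) topology, and `Gs n ∩ Ks (n + 1) = Ks n`. For Hausdorff `G` the subspace
topology of `⨆ n, Ks n` is then the direct-limit topology of the `Ks n` as well, since
`(⨆ n, Ks n) ∩ Gs n = Ks n` is closed in `Gs n`. -/
structure IsDirectLimitGelfandPair (Gs Ks : ℕ → Subgroup G) : Prop where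
  mono_G : Monotone Gs
  mono_K : Monotone Ks
  le : ∀ n, Ks n ≤ Gs n
  gelfand : ∀ n, IsGelfandPair ((Ks n).subgroupOf (Gs n))
  inter_eq : ∀ n, Gs n ⊓ Ks (n + 1) = Ks n
  exists_mem : ∀ g : G, ∃ n, g ∈ Gs n
  isOpen_of : ∀ U : Set G, (∀ n, IsOpen ((↑) ⁻¹' U : Set (Gs n))) → IsOpen U

/-- `φ` is a positive-definite function on the group `G`. -/
def IsPosDefFun (φ : G → ℂ) : Prop :=
  ∀ (n : ℕ) (g : Fin n → G) (c : Fin n → ℂ),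
    0 ≤ ∑ i, ∑ j, c i * star (c j) * φ ((g j)⁻¹ * g i)

variable {K : Subgroup G}

/-- `φ` is a spherical function with respect to the functional `μ` on `RUC_b(K)`: it is continuous,
and for all `x`, `y` the function `k ↦ φ (x k y)` lies in `RUC_b(K)` and `μ` takes the value
`φ x * φ y` on it. -/
def IsSphericalWrt (μ : RUCb K → ℂ) (φ : G → ℂ) : Prop :=
  Continuous φ ∧ ∀ x y : G, ∃ f : RUCb K,
    (∀ k : K, (f : BddFun K) k = φ (x * k * y)) ∧ μ f = φ x * φ y

variable (K) in
/-- `φ` is a (positive-definite, normalized) spherical function for `(G, K)`: it is spherical with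
respect to some invariant mean on `RUC_b(K)`. -/
def IsSpherical (φ : G → ℂ) : Prop :=
  IsPosDefFun φ ∧ φ 1 = 1 ∧
    ∃ μ : RUCb K →L[ℂ] ℂ, IsInvariantMean μ ∧ IsSphericalWrt μ φ

end Spherical

/-!
A character of `RUC_b(K)` is multiplicative, so the product of two functions that are spherical
with respect to one and the same character `χ` is spherical with respect to `χ`
(`IsSphericalWrt.mul_of_character`). The rest of the argument is that, for positive-definite
functions, sphericality does not depend on the invariant mean.

Let `φ` be positive definite, and write `φ (x⁻¹ y) = ⟪v x, v y⟫` with vectors that span a dense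
subspace of a Hilbert space (`IsPosDefFun.exists_hilbert`). An invariant mean `μ` averages the
vectors `v (k y)` over `k ∈ K` to a vector `m_μ y`, characterized by `⟪w, m_μ y⟫ = μ (k ↦ ⟪w, v (k y)⟫)`
(`exists_meanVector`). In terms of the representation of `G` on the Hilbert space, `v y ↦ m_μ y` is
the orthogonal projection onto the `K`-fixed vectors, whatever `μ` is. As
`μ (k ↦ φ (x k y)) = ⟪v x⁻¹, m_μ y⟫`, all invariant means take the same value on `k ↦ φ (x k y)`
(`IsPosDefFun.mean_eq_mean`).

An invariant character is positive, hence an invariant mean (`isInvariantMean_of_character`). If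
`K` is extremely amenable, two spherical functions are therefore both spherical with respect to one
invariant character, and so is their product. The product is positive definite by the Schur product
theorem, and so it is spherical with respect to every invariant mean.
-/

/-! ### Bounded functions and their translates -/

section BddFun

variable {H : Type*}

theorem BddFun.norm_apply_le (f : BddFun H) (h : H) : ‖f h‖ ≤ ‖f‖ :=
  lp.norm_apply_le_norm ENNReal.top_ne_zero f h

theorem BddFun.norm_le {f : BddFun H} {C : ℝ} (hC : 0 ≤ C) (hf : ∀ h, ‖f h‖ ≤ C) : ‖f‖ ≤ C :=
  lp.norm_le_of_forall_le hC hf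

theorem dist_leftTrans_le [Group H] (g : H) (f f' : BddFun H) :
    dist (leftTrans g f) (leftTrans g f') ≤ dist f f' := by
  rw [dist_eq_norm, dist_eq_norm]
  refine BddFun.norm_le (norm_nonneg _) fun h => ?_
  exact BddFun.norm_apply_le (f - f') (g⁻¹ * h)

end BddFun

/-! ### Characters of `RUC_b` as invariant means -/

section RUC

variable {H : Type*} [Group H] [TopologicalSpace H]

/-- `RUC_b(H)` is closed in `l^∞(H)`, because translations are isometric and a uniform limit of
continuous orbit maps is continuous. Hence it is a C⋆-algebra, and its characters are
⋆-homomorphisms of norm at most one. -/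
instance RUCb.isClosed : IsClosed (RUCb H : Set (BddFun H)) := by
  refine isClosed_of_closure_subset fun f hf => ?_
  change Continuous fun g : H => leftTrans g f
  refine continuous_of_uniform_approx_of_continuous fun u hu => ?_
  obtain ⟨ε, hε, hεu⟩ := Metric.mem_uniformity_dist.1 hu
  obtain ⟨f', hf', hd⟩ := Metric.mem_closure_iff.1 hf ε hε
  exact ⟨fun g => leftTrans g f', hf', fun g => hεu ((dist_leftTrans_le g f f').trans_lt hd)⟩

theorem RUCb.ext_apply {f f' : RUCb H} (h : ∀ k, (f : BddFun H) k = (f' : BddFun H) k) :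
    f = f' :=
  Subtype.ext (lp.ext (funext h))

theorem RUCb.trans_apply [IsTopologicalGroup H] (g : H) (f : RUCb H) (h : H) :
    (RUCb.trans g f : BddFun H) h = (f : BddFun H) (g⁻¹ * h) := rfl

theorem RUCb.algebraMap_apply (c : ℂ) (h : H) :
    ((algebraMap ℂ (RUCb H) c : RUCb H) : BddFun H) h = c := rfl

/-- A character of `RUC_b(H)` is positive: for `f ≥ 0` the value `χ f` is real, and it lies within
`‖f‖` of `‖f‖`, since `0 ≤ f ≤ ‖f‖` pointwise. -/
theorem characterSpace_nonneg (χ : WeakDual.characterSpace ℂ (RUCb H)) {f : RUCb H}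
    (hf : ∀ h, 0 ≤ (f : BddFun H) h) : 0 ≤ χ f := by
  have hsa : star f = f := RUCb.ext_apply fun h => by
    have := (Complex.nonneg_iff.1 (hf h)).2
    change star ((f : BddFun H) h) = _
    exact Complex.conj_eq_iff_im.2 this.symm
  have him : (χ f).im = 0 := by
    rw [← Complex.conj_eq_iff_im]
    have := map_star χ f
    rw [hsa] at this
    exact this.symm
  have hnorm : ‖algebraMap ℂ (RUCb H) ‖f‖ - f‖ ≤ ‖f‖ := by
    refine BddFun.norm_le (norm_nonneg _) fun h => ?_
    change ‖(‖f‖ : ℂ) - (f : BddFun H) h‖ ≤ ‖f‖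
    have h2 : ‖(f : BddFun H) h‖ ≤ ‖f‖ := BddFun.norm_apply_le _ h
    have h3 : (f : BddFun H) h = (((f : BddFun H) h).re : ℂ) :=
      Complex.ext rfl (Complex.nonneg_iff.1 (hf h)).2.symm
    have h4 := (Complex.nonneg_iff.1 (hf h)).1
    rw [h3] at h2 ⊢
    rw [← Complex.ofReal_sub]
    rw [Complex.norm_real, Real.norm_eq_abs] at h2 ⊢
    rw [abs_of_nonneg h4] at h2
    rw [abs_of_nonneg (by linarith)]
    linarith
  have hχ : ‖(‖f‖ : ℂ) - χ f‖ ≤ ‖f‖ := by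
    have : CompleteSpace (RUCb H) := RUCb.isClosed.completeSpace_coe
    have h := AlgHom.norm_apply_le_self χ (algebraMap ℂ (RUCb H) ‖f‖ - f)
    rw [map_sub χ, AlgHomClass.commutes] at h
    exact h.trans hnorm
  have hre := (Complex.re_le_norm _).trans hχ
  have hre' : 0 ≤ (χ f).re := by
    rw [Complex.sub_re, Complex.ofReal_re] at hre
    linarith
  exact Complex.nonneg_iff.2 ⟨hre', him.symm⟩

theorem isInvariantMean_of_character [IsTopologicalGroup H] (χ : WeakDual.characterSpace ℂ (RUCb H))
    (hχ : IsLeftInvariant χ) :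
    IsInvariantMean (WeakDual.CharacterSpace.toCLM χ) where
  map_one := map_one χ
  nonneg _ hf := characterSpace_nonneg χ hf
  invariant := hχ

end RUC

/-! ### Positive-definite functions -/

section PosDef

variable {G : Type*} [Group G]

theorem isPosDefFun_iff_posSemidef (φ : G → ℂ) :
    IsPosDefFun φ ↔ (Matrix.of fun x y : G => φ (x⁻¹ * y)).PosSemidef := by
  constructor
  · intro h
    constructor
    · -- The imaginary parts of these three nonnegative sums give `φ (y⁻¹ * x) = conj (φ (x⁻¹ * y))`.
      ext x y
      have h0 := h 1 ![1] ![1]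
      have h1 := h 2 ![x, y] ![1, 1]
      have h2 := h 2 ![x, y] ![1, Complex.I]
      simp [Fin.sum_univ_two, Complex.nonneg_iff] at h0 h1 h2
      simp only [Matrix.conjTranspose_apply, Matrix.of_apply]
      refine Complex.ext ?_ ?_ <;> simp <;> linarith [h0.2, h1.2, h2.2]
    · intro c
      let e := c.support.equivFin
      have := h c.support.card (fun i => (e.symm i : G)) (fun i => c (e.symm i))
      convert this using 1
      simp only [Finsupp.sum, Matrix.of_apply]
      rw [Finset.sum_comm, ← Finset.sum_coe_sort c.support, ← e.symm.sum_comp]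
      refine Finset.sum_congr rfl fun i _ => ?_
      rw [← Finset.sum_coe_sort c.support, ← e.symm.sum_comp]
      refine Finset.sum_congr rfl fun j _ => ?_
      ring
  · intro h n g c
    convert (h.submatrix g).dotProduct_mulVec_nonneg c using 1
    simp only [dotProduct, Matrix.mulVec, Matrix.submatrix_apply, Matrix.of_apply, Finset.mul_sum,
      Pi.star_apply]
    rw [Finset.sum_comm]
    refine Finset.sum_congr rfl fun i _ => Finset.sum_congr rfl fun j _ => ?_
    ring

theorem IsPosDefFun.mul {φ ψ : G → ℂ} (hφ : IsPosDefFun φ) (hψ : IsPosDefFun ψ) :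
    IsPosDefFun (φ * ψ) := by
  rw [isPosDefFun_iff_posSemidef] at *
  exact hφ.hadamard hψ

open scoped InnerProductSpace in
/-- A positive-definite function is the Gram kernel of a total family of vectors in a Hilbert
space. The space is the reproducing kernel Hilbert space of `(x, y) ↦ φ (x⁻¹ y)`, and the vectors
are its kernel functions. -/
theorem IsPosDefFun.exists_hilbert.{u} {G : Type u} [Group G] {φ : G → ℂ} (hφ : IsPosDefFun φ) :
    ∃ (E : Type u) (_ : NormedAddCommGroup E) (_ : InnerProductSpace ℂ E) (_ : CompleteSpace E)
      (v : G → E), (∀ x y, ⟪v x, v y⟫_ℂ = φ (x⁻¹ * y)) ∧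
        (Submodule.span ℂ (Set.range v)).topologicalClosure = ⊤ := by
  have hM := (isPosDefFun_iff_posSemidef φ).1 hφ
  let M : Matrix G G (ℂ →L[ℂ] ℂ) := .of fun x y => φ (x⁻¹ * y) • 1
  have hherm : ∀ x y, star (φ (y⁻¹ * x)) = φ (x⁻¹ * y) := fun x y => hM.1.apply x y
  have hMpos : M.PosSemidef := by
    have htfae := (RKHS.posSemidef_tfae (K := M)).out 0 2
    refine htfae.2 ⟨?_, fun c => ?_⟩
    · ext x y
      have := hherm x y
      simp [M, Matrix.conjTranspose_apply, ← this]
    · have := (Complex.nonneg_iff.1 (hM.2 c)).1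
      change 0 ≤ Complex.re _
      convert this using 2
      refine Finsupp.sum_congr fun x _ => Finsupp.sum_congr fun y _ => ?_
      simp only [M, Matrix.of_apply, FunLike.coe_smul, Pi.smul_apply,
        one_apply_eq_self, smul_eq_mul, RCLike.inner_apply, map_mul]
      rw [← hherm x y]
      simp [mul_comm]
  have : Fact M.PosSemidef := ⟨hMpos⟩
  refine ⟨RKHS.OfKernel M, inferInstance, inferInstance, inferInstance,
    fun x => RKHS.kerFun (RKHS.OfKernel M) x 1, fun x y => ?_, ?_⟩
  · rw [← RKHS.kernel_inner, RKHS.OfKernel.kernel_ofKernel, ← hherm x y]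
    simp [M]
  · rw [eq_top_iff, ← RKHS.kerFun_dense (RKHS.OfKernel M)]
    refine Submodule.topologicalClosure_mono (Submodule.span_le.2 ?_)
    rintro _ ⟨x, c, rfl⟩
    have : RKHS.kerFun (RKHS.OfKernel M) x c = c • RKHS.kerFun (RKHS.OfKernel M) x 1 := by
      rw [← map_smul, smul_eq_mul, mul_one]
    rw [this]
    exact Submodule.smul_mem _ _ (Submodule.subset_span ⟨x, rfl⟩)

end PosDef

/-! ### Means of bounded families of vectors -/

section Mean

open scoped InnerProductSpace

variable {K : Type*} [Group K] {E : Type*} [NormedAddCommGroup E] [InnerProductSpace ℂ E]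

/-- The coefficient map `w ↦ (k ↦ ⟪w, u k⟫)` of a bounded family `u` of vectors. It is
conjugate-linear. -/
noncomputable def coeffMap (u : K → E) {C : ℝ} (hu : ∀ k, ‖u k‖ ≤ C) : E →L⋆[ℂ] BddFun K :=
  LinearMap.mkContinuous
    { toFun := fun w => ⟨fun k => ⟪w, u k⟫_ℂ, memℓp_infty_iff.2 ⟨‖w‖ * C, by
        rintro _ ⟨k, rfl⟩
        exact (norm_inner_le_norm _ _).trans (by gcongr; exact hu k)⟩⟩
      map_add' := fun w w' => lp.ext (funext fun k => inner_add_left _ _ _)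
      map_smul' := fun c w => lp.ext (funext fun k => inner_smul_left _ _ _) } C
    fun w => BddFun.norm_le (mul_nonneg ((norm_nonneg _).trans (hu 1)) (norm_nonneg _)) fun k =>
      (norm_inner_le_norm _ _).trans (by rw [mul_comm]; gcongr; exact hu k)

theorem coeffMap_apply (u : K → E) {C : ℝ} (hu : ∀ k, ‖u k‖ ≤ C) (w : E) (k : K) :
    coeffMap u hu w k = ⟪w, u k⟫_ℂ := rfl

variable [TopologicalSpace K]

theorem coeffMap_mem_RUCb (u : K → E) {C : ℝ} (hu : ∀ k, ‖u k‖ ≤ C) {s : Set E}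
    (hs : (Submodule.span ℂ s).topologicalClosure = ⊤)
    (hmem : ∀ w ∈ s, coeffMap u hu w ∈ RUCb K) (w : E) : coeffMap u hu w ∈ RUCb K := by
  have hle : (Submodule.span ℂ s).topologicalClosure ≤
      (Subalgebra.toSubmodule (RUCb K).toSubalgebra).comap (coeffMap u hu).toLinearMap :=
    Submodule.topologicalClosure_minimal _ (Submodule.span_le.2 hmem)
      (RUCb.isClosed.preimage (coeffMap u hu).continuous)
  rw [hs] at hle
  exact hle (Submodule.mem_top (x := w))

/-- The weak mean of a bounded family `u` of vectors, obtained from the Riesz representation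
theorem: `⟪w, m⟫` is the value of `μ` at `k ↦ ⟪w, u k⟫`. The hypothesis on `f` avoids choosing a
membership proof for this coefficient. -/
theorem exists_meanVector [CompleteSpace E] (u : K → E) {C : ℝ} (hu : ∀ k, ‖u k‖ ≤ C)
    (hmem : ∀ w, coeffMap u hu w ∈ RUCb K) (μ : RUCb K →L[ℂ] ℂ) :
    ∃ m : E, ∀ (w : E) (f : RUCb K), (∀ k, (f : BddFun K) k = ⟪w, u k⟫_ℂ) → μ f = ⟪w, m⟫_ℂ := by
  -- The coefficient is conjugate-linear in `w`, and the Riesz theorem needs a linear functional.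
  let ℓ : E →L[ℂ] ℂ :=
    { toFun := fun w => star (μ ⟨coeffMap u hu w, hmem w⟩)
      map_add' := fun w w' => by
        rw [← star_add, ← map_add]
        congr 2
        exact Subtype.ext (map_add _ _ _)
      map_smul' := fun c w => by
        have : (⟨coeffMap u hu (c • w), hmem _⟩ : RUCb K) =
            star c • (⟨coeffMap u hu w, hmem w⟩ : RUCb K) :=
          Subtype.ext (map_smulₛₗ (coeffMap u hu) c w)
        rw [this, map_smul]
        simp
      cont := (μ.continuous.comp ((coeffMap u hu).continuous.subtype_mk hmem)).star }
  refine ⟨(InnerProductSpace.toDual ℂ E).symm ℓ, fun w f hf => ?_⟩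
  have hfw : f = ⟨coeffMap u hu w, hmem w⟩ := RUCb.ext_apply hf
  rw [← inner_conj_symm, InnerProductSpace.toDual_symm_apply, hfw]
  exact (star_star _).symm

end Mean

/-! ### Spherical functions and independence of the invariant mean -/

section Spherical

open scoped InnerProductSpace

variable {G : Type*} [Group G] [TopologicalSpace G] {K : Subgroup G}

/-- All invariant means agree on the functions `k ↦ φ (x k y)` when `φ` is positive definite: each
of them evaluates to the matrix coefficient of the orthogonal projection onto the `K`-fixed
vectors. The projection appears here through the vectors `m hμ y`, the mean of `k ↦ v (k y)`
with respect to `μ`. -/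
theorem IsPosDefFun.mean_eq_mean [IsTopologicalGroup G] {φ : G → ℂ} (hφ : IsPosDefFun φ)
    (hmem : ∀ x y : G, ∃ f : RUCb K, ∀ k : K, (f : BddFun K) k = φ (x * k * y))
    {μ ν : RUCb K →L[ℂ] ℂ} (hμ : IsInvariantMean μ) (hν : IsInvariantMean ν)
    {x y : G} {f : RUCb K} (hf : ∀ k : K, (f : BddFun K) k = φ (x * k * y)) : μ f = ν f := by
  obtain ⟨E, _, _, _, v, hv, hdense⟩ := hφ.exists_hilbert
  have hbound : ∀ (y : G) (k : K), ‖v (k * y)‖ ≤ ‖v 1‖ := fun y k => by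
    rw [← sq_le_sq₀ (norm_nonneg _) (norm_nonneg _), ← inner_self_eq_norm_sq (𝕜 := ℂ),
      ← inner_self_eq_norm_sq (𝕜 := ℂ), hv, hv]
    simp
  have hcoeff : ∀ y w, coeffMap (fun k : K => v (k * y)) (hbound y) w ∈ RUCb K := fun y =>
    coeffMap_mem_RUCb _ _ hdense <| by
      rintro _ ⟨x, rfl⟩
      obtain ⟨f, hf⟩ := hmem x⁻¹ y
      convert f.2
      ext k
      rw [coeffMap_apply, hv, hf, mul_assoc]
  -- Left invariance of `μ` makes the mean vector `K`-fixed, tested against the vectors `v x`.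
  have hvec : ∀ {μ : RUCb K →L[ℂ] ℂ}, IsInvariantMean μ → ∀ y : G, ∃ m : E,
      (∀ (w : E) (f : RUCb K), (∀ k : K, (f : BddFun K) k = ⟪w, v (k * y)⟫_ℂ) → μ f = ⟪w, m⟫_ℂ) ∧
      ∀ (l : K) (x : G), ⟪v (l * x), m⟫_ℂ = ⟪v x, m⟫_ℂ := fun {μ} hμ y => by
    obtain ⟨m, hm⟩ := exists_meanVector _ (hbound y) (hcoeff y) μ
    refine ⟨m, hm, fun l x => ?_⟩
    obtain ⟨f, hf⟩ := hmem x⁻¹ y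
    rw [← hm (v x) f fun k => by rw [hv, hf, mul_assoc], ← hμ.invariant l f]
    refine (hm _ _ fun k => ?_).symm
    rw [RUCb.trans_apply, hv, hf]
    simp [mul_assoc]
  choose m hm hminv using fun {μ : RUCb K →L[ℂ] ℂ} (hμ : IsInvariantMean μ) => hvec hμ
  -- The mean vector of `ν` is `K`-fixed, so the coefficient to which `μ` is applied is constant.
  have hproj : ∀ {μ ν : RUCb K →L[ℂ] ℂ} (hμ : IsInvariantMean μ) (hν : IsInvariantMean ν) (x y : G),
      ⟪m hν x, m hμ y⟫_ℂ = ⟪m hν x, v y⟫_ℂ := fun {μ ν} hμ hν x y => by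
    rw [← hm hμ y _ (algebraMap ℂ (RUCb K) ⟪m hν x, v y⟫_ℂ) fun k => ?_]
    · rw [Algebra.algebraMap_eq_smul_one, map_smul, hμ.map_one, smul_eq_mul, mul_one]
    · rw [RUCb.algebraMap_apply, ← inner_conj_symm, ← hminv hν x k y, inner_conj_symm]
  -- Conjugate symmetry of the inner product exchanges `μ` and `ν`: the averaging operators of any
  -- two invariant means are adjoint to each other, and therefore all equal.
  have hsymm : ∀ {μ ν : RUCb K →L[ℂ] ℂ} (hμ : IsInvariantMean μ) (hν : IsInvariantMean ν) (x y : G),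
      ⟪v x, m hμ y⟫_ℂ = ⟪m hν x, v y⟫_ℂ := fun {μ ν} hμ hν x y => by
    rw [← hproj hμ hν, ← inner_conj_symm, ← hproj hν hμ, inner_conj_symm]
  have hval : ∀ {μ : RUCb K →L[ℂ] ℂ} (hμ : IsInvariantMean μ), μ f = ⟪v x⁻¹, m hμ y⟫_ℂ :=
    fun hμ => hm hμ y _ f fun k => by rw [hv, hf, inv_inv, mul_assoc]
  rw [hval hμ, hval hν, hsymm hμ hν, hsymm hν hν]

theorem IsSphericalWrt.of_isInvariantMean [IsTopologicalGroup G] {φ : G → ℂ} (hφ : IsPosDefFun φ)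
    {μ ν : RUCb K →L[ℂ] ℂ} (hμ : IsInvariantMean μ) (hν : IsInvariantMean ν)
    (h : IsSphericalWrt μ φ) : IsSphericalWrt ν φ := by
  refine ⟨h.1, fun x y => ?_⟩
  obtain ⟨f, hf, hfμ⟩ := h.2 x y
  refine ⟨f, hf, ?_⟩
  rw [← hφ.mean_eq_mean (fun x y => (h.2 x y).imp fun _ => And.left) hμ hν hf, hfμ]

theorem IsSphericalWrt.mul_of_character {χ : WeakDual.characterSpace ℂ (RUCb K)} {φ ψ : G → ℂ}
    (hφ : IsSphericalWrt χ φ) (hψ : IsSphericalWrt χ ψ) : IsSphericalWrt χ (φ * ψ) := by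
  refine ⟨hφ.1.mul hψ.1, fun x y => ?_⟩
  obtain ⟨f, hf, hfχ⟩ := hφ.2 x y
  obtain ⟨g, hg, hgχ⟩ := hψ.2 x y
  refine ⟨f * g, fun k => ?_, ?_⟩
  · rw [Pi.mul_apply, ← hf, ← hg]
    rfl
  · rw [map_mul, hfχ, hgχ, Pi.mul_apply, Pi.mul_apply]
    ring

end Spherical

theorem mainTheorem2 {G : Type*} [Group G] [TopologicalSpace G] [IsTopologicalGroup G] [T2Space G]
    (Gs Ks : ℕ → Subgroup G) (hGK : IsDirectLimitGelfandPair Gs Ks)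
    (hK : IsExtremelyAmenable ↥(⨆ n, Ks n)) :
    (∀ φ ψ : G → ℂ, IsSpherical (⨆ n, Ks n) φ → IsSpherical (⨆ n, Ks n) ψ →
      IsSpherical (⨆ n, Ks n) (φ * ψ) ∧
      ∀ μ : RUCb ↥(⨆ n, Ks n) →L[ℂ] ℂ, IsInvariantMean μ → IsSphericalWrt μ (φ * ψ)) ∧
    (∀ χ : WeakDual.characterSpace ℂ (RUCb ↥(⨆ n, Ks n)), IsLeftInvariant χ →
      ∀ φ ψ : G → ℂ, IsSphericalWrt χ φ → IsSphericalWrt χ ψ → IsSphericalWrt χ (φ * ψ)) := by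
  refine ⟨?_, fun χ _ φ ψ hφ hψ => hφ.mul_of_character hψ⟩
  rintro φ ψ ⟨hφ, hφ1, μ, hμ, hφμ⟩ ⟨hψ, hψ1, ν, hν, hψν⟩
  obtain ⟨χ, hχ⟩ := hK
  have hχm := isInvariantMean_of_character χ hχ
  have hχφψ : IsSphericalWrt (WeakDual.CharacterSpace.toCLM χ) (φ * ψ) :=
    IsSphericalWrt.mul_of_character (χ := χ) (hφμ.of_isInvariantMean hφ hμ hχm)
      (hψν.of_isInvariantMean hψ hν hχm)
  exact ⟨⟨hφ.mul hψ, by simp [hφ1, hψ1], _, hχm, hχφψ⟩,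
    fun _ hm => hχφψ.of_isInvariantMean (hφ.mul hψ) hχm hm⟩
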